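/- Let $k$ be a natural number and, for $1\le i\le k$, let $d_i\ge 3$ and let $T_i$ be the homogeneous tree of valency $d_i$, with a distinguished vertex $o_i$ and a distinguished end $\omega_i$ (ends are equivalence classes of geodesic rays, two rays being equivalent if they share infinitely many vertices). Let $\operatorname{Aff}(T_i)$ be the group of all automorphisms of $T_i$ that fix $\omega_i$, with the topology of pointwise convergence on vertices. Let $h_i(v)=d(v,c)-d(o_i,c)$, where $c$ is the first common vertex of the geodesic rays from $v$ and from $o_i$ to $\omega_i$, and let $\operatorname{Hor}(T_i)=\{\alpha\in\operatorname{Aff}(T_i): h_i(\alpha o_i)=0\}$. A subgroup of $\operatorname{Aff}(T_i)$ is called exceptional if it is contained in $\operatorname{Hor}(T_i)$ or if there is an end of $T_i$ other than $\omega_i$ that is fixed by all its elements. Let $P=\prod_{i=1}^k\operatorname{Aff}(T_i)$ with the product topology and coordinate projections $\pi_j$. A closed subgroup $\Gamma$ of $P$ is called fully exceptional if $\pi_j(\Gamma)$ is exceptional for every $j\in\{1,\dots,k\}$. Let $\mu$ be a Borel probability measure on $P$ such that the closed subgroup of $P$ generated by the support of $\mu$ is not fully exceptional. Then the random walk $(P,\mu)$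 is transient: if $X_1,X_2,\dots$ are independent random elements of $P$ with distribution $\mu$ and $R_n=X_1X_2\cdots X_n$, then almost surely, for every compact set $E\subseteq P$, we have $R_n\notin E$ for all sufficiently large $n$. -/

import Mathlib

open MeasureTheory Filter Topology

namespace TreeWalk

universe u

variable {V : Type u} {G : SimpleGraph V}

/-! ### Homogeneous trees, geodesic rays and ends -/

/-- `G` is a homogeneous tree of valency `d`: a connected graph without cycles in which every
vertex has exactly `d` neighbours. -/
structure IsHomogeneousTree (G : SimpleGraph V) (d : ℕ) : Prop where
  isTree : G.IsTree
  encard_neighborSet : ∀ v : V, (G.neighborSet v).encard = d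

/-- A geodesic ray: a singly infinite sequence of successive neighbours without backtracking. -/
structure Ray (G : SimpleGraph V) where
  toFun : ℕ → V
  adj : ∀ n, G.Adj (toFun n) (toFun (n + 1))
  ne_backtrack : ∀ n, toFun n ≠ toFun (n + 2)

instance : CoeFun (Ray G) (fun _ => ℕ → V) := ⟨Ray.toFun⟩

/-- Two rays are equivalent if they have infinitely many vertices in common. -/
def RayEquiv (r s : Ray G) : Prop := (Set.range r ∩ Set.range s).Infinite

/-- In a tree, a vertex at given distances from the ends of a geodesic segment, and lying on that
segment, is unique. -/
theorem geodesic_unique (hG : G.IsTree) {x y z z' : V}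
    (h1 : G.dist x z = G.dist x z') (h2 : G.dist z y = G.dist z' y)
    (h3 : G.dist x z + G.dist z y = G.dist x y) : z = z' := by
  obtain ⟨p, hp⟩ := hG.connected.exists_walk_length_eq_dist x z
  obtain ⟨q, hq⟩ := hG.connected.exists_walk_length_eq_dist z y
  obtain ⟨p', hp'⟩ := hG.connected.exists_walk_length_eq_dist x z'
  obtain ⟨q', hq'⟩ := hG.connected.exists_walk_length_eq_dist z' y
  have e1 : (p.append q).IsPath :=
    SimpleGraph.Walk.isPath_of_length_eq_dist _ (by simp [hp, hq, h3])
  have e2 : (p'.append q').IsPath :=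
    SimpleGraph.Walk.isPath_of_length_eq_dist _ (by simp [hp', hq', ← h1, ← h2, h3])
  have e : p.append q = p'.append q' := (hG.existsUnique_path x y).unique e1 e2
  have a : (p.append q).getVert (G.dist x z) = z := by
    rw [SimpleGraph.Walk.getVert_append]; simp [hp]
  have b : (p'.append q').getVert (G.dist x z) = z' := by
    rw [SimpleGraph.Walk.getVert_append]; simp [hp', h1]
  rw [← a, e, b]

namespace Ray

/-- The ray obtained by forgetting the first `m` vertices. -/
def shift (r : Ray G) (m : ℕ) : Ray G where
  toFun n := r (m + n)
  adj n := r.adj (m + n)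
  ne_backtrack n := r.ne_backtrack (m + n)

/-- The image of a ray under an automorphism. -/
def map (α : G ≃g G) (r : Ray G) : Ray G where
  toFun n := α (r n)
  adj n := α.map_rel_iff.2 (r.adj n)
  ne_backtrack n h := r.ne_backtrack n (α.injective h)

theorem dist_zero (hG : G.IsTree) (r : Ray G) (n : ℕ) : G.dist (r 0) (r n) = n := by
  induction n using Nat.strong_induction_on with
  | _ n ih =>
    match n with
    | 0 => simp
    | 1 => exact SimpleGraph.dist_eq_one_iff_adj.2 (r.adj 0)
    | n + 2 =>
      have i0 := ih n (by omega)
      have i1 := ih (n + 1) (by omega)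
      rcases hG.dist_eq_dist_add_one_of_adj (r 0) (r.adj (n + 1)) with h | h
      · exfalso
        rw [i1] at h
        have h' : G.dist (r 0) (r (n + 1 + 1)) = n := by omega
        refine r.ne_backtrack n
          (geodesic_unique hG (x := r 0) (y := r (n + 1)) (by rw [i0]; exact h'.symm) ?_ ?_)
        · rw [SimpleGraph.dist_eq_one_iff_adj.2 (r.adj n),
            SimpleGraph.dist_eq_one_iff_adj.2 (r.adj (n + 1)).symm]
        · rw [i0, i1, SimpleGraph.dist_eq_one_iff_adj.2 (r.adj n)]
      · rw [i1] at h; exact h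

theorem dist_add (hG : G.IsTree) (r : Ray G) (m n : ℕ) : G.dist (r m) (r (m + n)) = n :=
  (r.shift m).dist_zero hG n

theorem injective (hG : G.IsTree) (r : Ray G) : Function.Injective r := by
  intro a b h
  wlog hab : a ≤ b generalizing a b
  · exact (this h.symm (by omega)).symm
  obtain ⟨c, rfl⟩ := Nat.exists_eq_add_of_le hab
  have := r.dist_add hG a c
  rw [← h, SimpleGraph.dist_self] at this
  omega

end Ray

theorem rayEquiv_of_shift (hG : G.IsTree) {r s : Ray G} {m n : ℕ}
    (h : ∀ i, r (m + i) = s (n + i)) : RayEquiv r s := by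
  have hinj : Function.Injective (r.shift m) := (r.shift m).injective hG
  refine (Set.infinite_range_of_injective hinj).mono ?_
  rintro _ ⟨i, rfl⟩
  exact ⟨⟨m + i, rfl⟩, ⟨n + i, (h i).symm⟩⟩

theorem RayEquiv.exists_shift (hG : G.IsTree) {r s : Ray G} (h : RayEquiv r s) :
    ∃ m n, ∀ i, r (m + i) = s (n + i) := by
  obtain ⟨_, ⟨m, rfl⟩, ⟨n, hn⟩⟩ := h.nonempty
  refine ⟨m, n, fun i => ?_⟩
  have hfin : (r '' Set.Iic (m + i) ∪ s '' Set.Iic (n + i)).Finite :=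
    ((Set.finite_Iic _).image _).union ((Set.finite_Iic _).image _)
  obtain ⟨v, ⟨⟨a, ha⟩, ⟨b, hb⟩⟩, hv⟩ := (h.sdiff hfin).nonempty
  have ham : m + i < a := by
    by_contra hc
    exact hv (Or.inl ⟨a, not_lt.1 hc, ha⟩)
  have hbn : n + i < b := by
    by_contra hc
    exact hv (Or.inr ⟨b, not_lt.1 hc, hb⟩)
  obtain ⟨a', rfl⟩ := Nat.exists_eq_add_of_lt ham
  obtain ⟨b', rfl⟩ := Nat.exists_eq_add_of_lt hbn
  have d1 : G.dist (r m) (r (m + i)) = i := r.dist_add hG m i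
  have d2 : G.dist (s n) (s (n + i)) = i := s.dist_add hG n i
  have d3 : G.dist (r (m + i)) v = a' + 1 := by
    rw [← ha]; exact r.dist_add hG (m + i) (a' + 1)
  have d4 : G.dist (s (n + i)) v = b' + 1 := by
    rw [← hb]; exact s.dist_add hG (n + i) (b' + 1)
  have d5 : G.dist (r m) v = i + (a' + 1) := by
    rw [← ha, show m + i + a' + 1 = m + (i + (a' + 1)) by omega]; exact r.dist_add hG m _
  have d6 : G.dist (r m) v = i + (b' + 1) := by
    rw [← hb, ← hn, show n + i + b' + 1 = n + (i + (b' + 1)) by omega]; exact s.dist_add hG n _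
  refine geodesic_unique hG (x := r m) (y := v) ?_ ?_ ?_
  · rw [d1, ← hn, d2]
  · omega
  · omega

/-- Equivalence of rays in a tree is an equivalence relation. -/
def raySetoid (hG : G.IsTree) : Setoid (Ray G) where
  r := RayEquiv
  iseqv :=
    { refl := fun r => rayEquiv_of_shift hG (m := 0) (n := 0) fun _ => rfl
      symm := fun {r s} h => by
        unfold RayEquiv at h ⊢
        rwa [Set.inter_comm]
      trans := fun {r s t} h k => by
        obtain ⟨m, n, h⟩ := h.exists_shift hG
        obtain ⟨p, q, k⟩ := k.exists_shift hG
        refine rayEquiv_of_shift hG (m := m + p) (n := q + n) fun i => ?_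
        rw [show m + p + i = m + (p + i) by omega, h,
          show n + (p + i) = p + (n + i) by omega, k, show q + n + i = q + (n + i) by omega] }

/-- The set of ends of a tree: equivalence classes of rays. -/
def Ends (hG : G.IsTree) : Type u := Quotient (raySetoid hG)

/-- The end represented by a ray. -/
def Ray.toEnd (hG : G.IsTree) (r : Ray G) : Ends hG := Quotient.mk (raySetoid hG) r

/-- From every vertex `v` there is a ray starting at `v` and representing a given end. -/
theorem exists_ray (hG : G.IsTree) (v : V) (ξ : Ends hG) :
    ∃ r : Ray G, r 0 = v ∧ r.toEnd hG = ξ := by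
  obtain ⟨s, rfl⟩ := Quotient.exists_rep ξ
  obtain ⟨n, hn⟩ : ∃ n, ∀ m, G.dist v (s n) ≤ G.dist v (s m) := by
    exact ⟨_, fun m => Function.argmin_le (fun n => G.dist v (s n)) m⟩
  obtain ⟨p, hpath, hp⟩ := hG.connected.exists_path_of_dist v (s n)
  set D := p.length with hD
  have hend : p.getVert D = s n := p.getVert_length
  let f : ℕ → V := fun i => if i < D then p.getVert i else s (n + (i - D))
  have f1 : ∀ i, i ≤ D → f i = p.getVert i := by
    intro i hi
    rcases hi.lt_or_eq with h | rfl
    · simp [f, h]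
    · simp [f, hend]
  have f2 : ∀ i, f (D + i) = s (n + i) := by
    intro i; simp [f]
  refine ⟨⟨f, fun i => ?_, fun i => ?_⟩, ?_, ?_⟩
  · rcases lt_or_ge i D with h | h
    · rw [f1 i h.le, f1 (i + 1) h]
      exact p.adj_getVert_succ h
    · obtain ⟨j, rfl⟩ := Nat.exists_eq_add_of_le h
      rw [f2, add_assoc, f2]
      exact s.adj (n + j)
  · rcases lt_or_ge i D with h | h
    · rcases (show i + 1 ≤ D from h).lt_or_eq with h' | h'
      · rw [f1 i h.le, f1 (i + 2) h']
        intro he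
        have := hpath.getVert_injOn (show i ≤ p.length from h.le)
          (show i + 2 ≤ p.length from h') he
        omega
      · have e1 : f (i + 2) = s (n + 1) := by
          rw [show i + 2 = D + 1 by omega, f2]
        rw [f1 i h.le, e1]
        intro he
        have a : G.dist v (p.getVert i) ≤ i := by
          have := SimpleGraph.dist_le (p.take i)
          simpa [h.le] using this.trans (by simp)
        have b := hn (n + 1)
        rw [← he, ← hp] at b
        omega
    · obtain ⟨j, rfl⟩ := Nat.exists_eq_add_of_le h
      rw [f2, add_assoc, f2]
      exact s.ne_backtrack (n + j)
  · change f 0 = v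
    rw [f1 0 (Nat.zero_le _), p.getVert_zero]
  · exact Quotient.sound (s := raySetoid hG) (rayEquiv_of_shift hG (m := D) (n := n) f2)

/-- The geodesic ray from the vertex `v` to the end `ξ`. -/
noncomputable def rayFrom (hG : G.IsTree) (v : V) (ξ : Ends hG) : Ray G :=
  (exists_ray hG v ξ).choose

theorem rayFrom_zero (hG : G.IsTree) (v : V) (ξ : Ends hG) : rayFrom hG v ξ 0 = v :=
  (exists_ray hG v ξ).choose_spec.1

theorem toEnd_rayFrom (hG : G.IsTree) (v : V) (ξ : Ends hG) : (rayFrom hG v ξ).toEnd hG = ξ :=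
  (exists_ray hG v ξ).choose_spec.2

theorem exists_common_vertex (hG : G.IsTree) (v o : V) (ξ : Ends hG) :
    ∃ n, rayFrom hG v ξ n ∈ Set.range (rayFrom hG o ξ) := by
  have h : RayEquiv (rayFrom hG v ξ) (rayFrom hG o ξ) :=
    Quotient.exact (s := raySetoid hG) ((toEnd_rayFrom hG v ξ).trans (toEnd_rayFrom hG o ξ).symm)
  obtain ⟨_, ⟨n, rfl⟩, hw⟩ := h.nonempty
  exact ⟨n, hw⟩

open scoped Classical in
/-- The first common vertex of the geodesic rays from `v` and from `o` to the end `ω`. -/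
noncomputable def firstCommonVertex (hG : G.IsTree) (ω : Ends hG) (v o : V) : V :=
  rayFrom hG v ω (Nat.find (exists_common_vertex hG v o ω))

/-- The Busemann function `h(v) = d(v, c) - d(o, c)`, where `c` is the first common vertex of the
geodesic rays from `v` and from `o` to `ω`. -/
noncomputable def busemann (hG : G.IsTree) (ω : Ends hG) (o v : V) : ℤ :=
  (G.dist v (firstCommonVertex hG ω v o) : ℤ) - (G.dist o (firstCommonVertex hG ω v o) : ℤ)

/-! ### The automorphism group and its affine subgroup

The automorphism group is Mathlib's group `G ≃g G`, under composition. -/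

/-- The topology of pointwise convergence (compact-open topology) on the automorphism group, the
vertex set being discrete. -/
instance autTopology : TopologicalSpace (G ≃g G) :=
  TopologicalSpace.induced (fun α : G ≃g G => (α : V → V))
    (@Pi.topologicalSpace V (fun _ => V) (fun _ => ⊥))

/-- The sets of automorphisms which agree with `α` on a finite set of vertices form a neighbourhood
basis of `α`. -/
theorem nhds_aut (α : G ≃g G) :
    (𝓝 α).HasBasis (fun F : Set V => F.Finite) (fun F => {β : G ≃g G | ∀ v ∈ F, β v = α v}) := by
  let _ : TopologicalSpace V := ⊥
  have : DiscreteTopology V := ⟨rfl⟩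
  have h1 : 𝓝 α = Filter.comap (fun α : G ≃g G => (α : V → V)) (𝓝 (α : V → V)) :=
    nhds_induced _ _
  rw [h1, nhds_pi]
  refine ⟨fun s => ?_⟩
  rw [Filter.mem_comap]
  constructor
  · rintro ⟨t, ht, hts⟩
    rw [Filter.mem_pi] at ht
    obtain ⟨I, hI, U, hU, hUt⟩ := ht
    refine ⟨I, hI, fun β hβ => hts (hUt fun v hv => ?_)⟩
    have : (β : V → V) v = α v := hβ v hv
    change β v ∈ U v
    rw [this]
    exact mem_of_mem_nhds (hU v)
  · rintro ⟨F, hF, hFs⟩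
    refine ⟨F.pi fun v => {α v}, ?_, fun β hβ => hFs fun v hv => hβ v hv⟩
    exact Filter.pi_mem_pi hF fun v _ => by simp [nhds_discrete]

instance : IsTopologicalGroup (G ≃g G) where
  continuous_mul := by
    rw [continuous_iff_continuousAt]
    rintro ⟨α, β⟩
    rw [ContinuousAt, nhds_prod_eq, ((nhds_aut α).prod (nhds_aut β)).tendsto_iff (nhds_aut _)]
    intro F hF
    refine ⟨(β '' F, F), ⟨hF.image _, hF⟩, ?_⟩
    rintro ⟨γ, δ⟩ ⟨h1, h2⟩ v hv
    have a : δ v = β v := h2 v hv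
    have b : γ (β v) = α (β v) := h1 _ ⟨v, hv, rfl⟩
    change γ (δ v) = α (β v)
    rw [a, b]
  continuous_inv := by
    rw [continuous_iff_continuousAt]
    intro α
    rw [ContinuousAt, (nhds_aut α).tendsto_iff (nhds_aut _)]
    intro F hF
    refine ⟨(α⁻¹ : G ≃g G) '' F, hF.image _, fun γ h v hv => ?_⟩
    have a : γ ((α⁻¹ : G ≃g G) v) = α ((α⁻¹ : G ≃g G) v) := h _ ⟨v, hv, rfl⟩
    rw [RelIso.apply_inv_self] at a
    apply γ.injective
    rw [RelIso.apply_inv_self, a]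

/-- Automorphisms of a tree act on its ends. -/
instance (hG : G.IsTree) : MulAction (G ≃g G) (Ends hG) where
  smul α := Quotient.map (sa := raySetoid hG) (sb := raySetoid hG) (Ray.map α) (by
    intro r s h
    obtain ⟨m, n, h⟩ := RayEquiv.exists_shift hG h
    exact rayEquiv_of_shift hG (m := m) (n := n) fun i => congrArg α (h i))
  one_smul ξ := by
    obtain ⟨r, rfl⟩ := Quotient.exists_rep ξ
    rfl
  mul_smul α β ξ := by
    obtain ⟨r, rfl⟩ := Quotient.exists_rep ξ
    rfl

theorem smul_toEnd (hG : G.IsTree) (α : G ≃g G) (r : Ray G) :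
    α • r.toEnd hG = (r.map α).toEnd hG := rfl

/-- The affine group of a tree with distinguished end `ω`: all automorphisms fixing `ω`, with the
subspace topology. -/
abbrev Aff (hG : G.IsTree) (ω : Ends hG) : Subgroup (G ≃g G) := MulAction.stabilizer (G ≃g G) ω

/-- The horocyclic map `φ(α) = h(α o)`. -/
noncomputable def horocyclic (hG : G.IsTree) (ω : Ends hG) (o : V) (α : Aff hG ω) : ℤ :=
  busemann hG ω o ((α : G ≃g G) o)

/-- The horocyclic group, as a subset of the affine group: the kernel of the horocyclic map. -/
def Hor (hG : G.IsTree) (ω : Ends hG) (o : V) : Set (Aff hG ω) :=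
  {α | horocyclic hG ω o α = 0}

/-- A subgroup of the affine group is exceptional if it is contained in the horocyclic group or
all of its elements fix a common end other than `ω`. -/
def Exceptional {hG : G.IsTree} {ω : Ends hG} (o : V) (Γ : Subgroup (Aff hG ω)) : Prop :=
  (Γ : Set (Aff hG ω)) ⊆ Hor hG ω o ∨
    ∃ ξ : Ends hG, ξ ≠ ω ∧ ∀ γ ∈ Γ, (γ : G ≃g G) • ξ = ξ

/-! ### Products of affine groups -/

section Product

variable {ι : Type*} {W : ι → Type u} {T : ∀ i, SimpleGraph (W i)}

/-- The direct product of the affine groups, with the product topology. -/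
abbrev AffProd (hT : ∀ i, (T i).IsTree) (ω : ∀ i, Ends (hT i)) : Type _ :=
  ∀ i, Aff (hT i) (ω i)

/-- A subgroup of the product is fully exceptional if each of its projections is exceptional. -/
def FullyExceptional {hT : ∀ i, (T i).IsTree} {ω : ∀ i, Ends (hT i)} (o : ∀ i, W i)
    (Γ : Subgroup (AffProd hT ω)) : Prop :=
  ∀ j, Exceptional (o j) (Γ.map (Pi.evalMonoidHom (fun i => Aff (hT i) (ω i)) j))

end Product

/-! ### Random walks -/

section Walk

variable {P : Type*} [Group P]

/-- The right random walk with increments `x 0, x 1, …`: the product of the first `n` of them, in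
this order. -/
def rightWalk (x : ℕ → P) : ℕ → P
  | 0 => 1
  | n + 1 => rightWalk x n * x n

variable [TopologicalSpace P] [MeasurableSpace P]

/-- The closed subgroup generated by the support of `μ`. -/
def closedGroupGenerated [IsTopologicalGroup P] (μ : Measure P) : Subgroup P :=
  (Subgroup.closure μ.support).topologicalClosure

/-- The random walk is transient: for almost every sequence of independent increments with
distribution `μ`, the right random walk eventually leaves every compact set. -/
def IsTransient (μ : Measure P) : Prop :=
  ∀ᵐ x ∂(Measure.infinitePi fun _ : ℕ => μ),
    ∀ E : Set P, IsCompact E → ∀ᶠ n in atTop, rightWalk x n ∉ E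

end Walk

end TreeWalk

namespace TreeWalk

section Potential

open scoped ENNReal NNReal

variable {Ω : Type*} {p : Ω → Ω → ℝ≥0∞}

open scoped Classical in
/-- The powers of the nonnegative matrix `p`. -/
noncomputable def stepPow (p : Ω → Ω → ℝ≥0∞) : ℕ → Ω → Ω → ℝ≥0∞
  | 0 => fun x y => if x = y then 1 else 0
  | n + 1 => fun x y => ∑' w, stepPow p n x w * p w y

theorem stepPow_zero_self (p : Ω → Ω → ℝ≥0∞) (x : Ω) : stepPow p 0 x x = 1 := by
  simp [stepPow]

theorem stepPow_zero_of_ne (p : Ω → Ω → ℝ≥0∞) {x y : Ω} (h : x ≠ y) : stepPow p 0 x y = 0 := by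
  simp [stepPow, h]

theorem stepPow_succ (p : Ω → Ω → ℝ≥0∞) (n : ℕ) (x y : Ω) :
    stepPow p (n + 1) x y = ∑' w, stepPow p n x w * p w y := rfl

theorem stepPow_succ_left (p : Ω → Ω → ℝ≥0∞) (n : ℕ) (x y : Ω) :
    stepPow p (n + 1) x y = ∑' w, p x w * stepPow p n w y := by
  induction n generalizing y with
  | zero =>
    rw [stepPow_succ, tsum_eq_single x, tsum_eq_single y]
    · simp [stepPow_zero_self]
    · intro w hw; simp [stepPow_zero_of_ne p hw]
    · intro w hw; simp [stepPow_zero_of_ne p hw.symm]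
  | succ n ih =>
    rw [stepPow_succ]
    simp_rw [ih, stepPow_succ p n, ← ENNReal.tsum_mul_right, ← ENNReal.tsum_mul_left]
    rw [ENNReal.tsum_comm]
    simp_rw [mul_assoc]

theorem stepPow_swap (p : Ω → Ω → ℝ≥0∞) (n : ℕ) (x y : Ω) :
    stepPow (Function.swap p) n x y = stepPow p n y x := by
  induction n generalizing y with
  | zero =>
    rcases eq_or_ne x y with rfl | h
    · simp [stepPow_zero_self]
    · rw [stepPow_zero_of_ne _ h, stepPow_zero_of_ne _ h.symm]
  | succ n ih =>
    rw [stepPow_succ, stepPow_succ_left]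
    simp_rw [ih, Function.swap, mul_comm]

theorem tsum_stepPow_le (hp : ∀ x, ∑' y, p x y ≤ 1) (n : ℕ) (x : Ω) :
    ∑' y, stepPow p n x y ≤ 1 := by
  induction n with
  | zero =>
    rw [tsum_eq_single x fun y hy => stepPow_zero_of_ne p hy.symm, stepPow_zero_self]
  | succ n ih =>
    simp_rw [stepPow_succ]
    rw [ENNReal.tsum_comm]
    simp_rw [ENNReal.tsum_mul_left]
    refine le_trans (ENNReal.tsum_le_tsum fun w => ?_) ih
    exact mul_le_of_le_one_right' (hp w)

theorem stepPow_le_one (hp : ∀ x, ∑' y, p x y ≤ 1) (n : ℕ) (x y : Ω) : stepPow p n x y ≤ 1 :=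
  (ENNReal.le_tsum y).trans (tsum_stepPow_le hp n x)

/-- The Green function of the matrix `p` with parameter `s`. -/
noncomputable def green (p : Ω → Ω → ℝ≥0∞) (s : ℝ≥0∞) (x y : Ω) : ℝ≥0∞ :=
  ∑' n, s ^ n * stepPow p n x y

theorem green_swap (p : Ω → Ω → ℝ≥0∞) (s : ℝ≥0∞) (x y : Ω) :
    green (Function.swap p) s x y = green p s y x := by
  simp [green, stepPow_swap]

theorem green_eq (p : Ω → Ω → ℝ≥0∞) (s : ℝ≥0∞) (x y : Ω) :
    green p s x y = stepPow p 0 x y + s * ∑' w, p x w * green p s w y := by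
  have h : ∑' w, p x w * green p s w y = ∑' n, s ^ n * stepPow p (n + 1) x y := by
    simp_rw [green, stepPow_succ_left, ← ENNReal.tsum_mul_left]
    rw [ENNReal.tsum_comm]
    refine tsum_congr fun n => tsum_congr fun w => by ring
  rw [h, green, tsum_eq_zero_add' ENNReal.summable, ← ENNReal.tsum_mul_left]
  simp_rw [pow_succ', mul_assoc, pow_zero, one_mul]

theorem one_le_green_self (p : Ω → Ω → ℝ≥0∞) (s : ℝ≥0∞) (x : Ω) : 1 ≤ green p s x x := by
  rw [green_eq, stepPow_zero_self]
  exact le_self_add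

theorem green_le_inv (hp : ∀ x, ∑' y, p x y ≤ 1) (s : ℝ≥0∞) (x y : Ω) :
    green p s x y ≤ (1 - s)⁻¹ := by
  rw [← ENNReal.tsum_geometric]
  exact ENNReal.tsum_le_tsum fun n => mul_le_of_le_one_right' (stepPow_le_one hp n x y)

theorem green_ne_top (hp : ∀ x, ∑' y, p x y ≤ 1) {s : ℝ≥0∞} (hs : s < 1) (x y : Ω) :
    green p s x y ≠ ∞ := by
  refine ne_top_of_le_ne_top ?_ (green_le_inv hp s x y)
  simpa [tsub_eq_zero_iff_le] using hs

/-- The maximum principle. -/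
theorem green_le_green_self (hp : ∀ x, ∑' y, p x y ≤ 1) {s : ℝ≥0∞} (hs : s < 1) (x y : Ω) :
    green p s x y ≤ green p s y y := by
  set M := ⨆ x, green p s x y with hM
  have hMtop : M ≠ ∞ := by
    refine ne_top_of_le_ne_top (b := (1 - s)⁻¹) (by simpa [tsub_eq_zero_iff_le] using hs) ?_
    exact iSup_le fun x => green_le_inv hp s x y
  have key : M ≤ max (s * M) (green p s y y) := by
    refine iSup_le fun z => ?_
    rcases eq_or_ne z y with rfl | hz
    · exact le_max_right _ _
    · refine le_trans ?_ (le_max_left _ _)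
      rw [green_eq, stepPow_zero_of_ne p hz, zero_add]
      gcongr
      calc ∑' w, p z w * green p s w y ≤ ∑' w, p z w * M := by
            gcongr with w
            exact le_iSup (fun x => green p s x y) w
        _ ≤ M := by
            rw [ENNReal.tsum_mul_right]
            exact mul_le_of_le_one_left' (hp z)
  refine (le_iSup (fun x => green p s x y) x).trans ?_
  rcases le_max_iff.1 key with h | h
  · rcases eq_or_ne M 0 with h0 | h0
    · rw [← hM, h0]; exact zero_le
    · exfalso
      have : s * M < 1 * M := ENNReal.mul_lt_mul_left h0 hMtop hs
      rw [one_mul] at this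
      exact absurd h this.not_ge
  · exact h

theorem green_le_green_self_left (hp : ∀ y, ∑' x, p x y ≤ 1) {s : ℝ≥0∞} (hs : s < 1) (x y : Ω) :
    green p s x y ≤ green p s x x := by
  rw [← green_swap p s y x, ← green_swap p s x x]
  exact green_le_green_self (p := Function.swap p) hp hs y x

/-- One-sided asymptotic comparison as the parameter increases to `1`. -/
def AsympLE (f g : ℝ≥0∞ → ℝ≥0∞) : Prop :=
  ∀ c : ℝ≥0, c < 1 → ∀ᶠ s in 𝓝[<] (1 : ℝ≥0∞), c * f s ≤ g s

theorem eventually_lt_one : ∀ᶠ s in 𝓝[<] (1 : ℝ≥0∞), s < 1 := eventually_mem_nhdsWithin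

instance neBot_nhdsLT_one : (𝓝[<] (1 : ℝ≥0∞)).NeBot :=
  nhdsLT_neBot_of_exists_lt ⟨0, zero_lt_one⟩

theorem AsympLE.mono {f g g' : ℝ≥0∞ → ℝ≥0∞} (h : AsympLE f g) (hg : ∀ s < 1, g s ≤ g' s) :
    AsympLE f g' := fun c hc => by
  filter_upwards [h c hc, eventually_lt_one] with s h1 h2
  exact h1.trans (hg s h2)

theorem AsympLE.tendsto_top {f g : ℝ≥0∞ → ℝ≥0∞} (h : AsympLE f g)
    (hf : Tendsto f (𝓝[<] 1) (𝓝 ∞)) : Tendsto g (𝓝[<] 1) (𝓝 ∞) := by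
  have h2 : (2⁻¹ : ℝ≥0) < 1 := NNReal.inv_lt_one_iff (by norm_num) |>.2 (by norm_num)
  have : Tendsto (fun s => ((2⁻¹ : ℝ≥0) : ℝ≥0∞) * f s) (𝓝[<] 1) (𝓝 ∞) := by
    have := ENNReal.Tendsto.const_mul (a := ((2⁻¹ : ℝ≥0) : ℝ≥0∞)) hf (Or.inl (by simp))
    rwa [ENNReal.mul_top (by simp)] at this
  exact tendsto_nhds_top_mono this (h _ h2)

/-- The state `y` is recurrent: its Green function blows up. -/
def Recurrent (p : Ω → Ω → ℝ≥0∞) (y : Ω) : Prop :=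
  Tendsto (fun s => green p s y y) (𝓝[<] 1) (𝓝 ∞)

theorem recurrent_swap_iff {y : Ω} : Recurrent (Function.swap p) y ↔ Recurrent p y := by
  simp [Recurrent, green_swap]

theorem recurrent_of_tsum_eq_top (hp : ∀ x, ∑' y, p x y ≤ 1) {x y : Ω}
    (h : ∑' n, stepPow p n x y = ∞) : Recurrent p y := by
  refine ENNReal.tendsto_nhds_top fun N => ?_
  obtain ⟨F, hF⟩ : ∃ F : Finset ℕ, (N : ℝ≥0∞) < ∑ n ∈ F, stepPow p n x y := by
    rw [ENNReal.tsum_eq_iSup_sum] at h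
    exact lt_iSup_iff.1 (h ▸ ENNReal.natCast_lt_top N)
  have hc : Continuous fun s : ℝ≥0∞ => ∑ n ∈ F, s ^ n * stepPow p n x y :=
    continuous_finsetSum _ fun n _ => (ENNReal.continuous_mul_const
      (ne_top_of_le_ne_top ENNReal.one_ne_top (stepPow_le_one hp n x y))).comp
        (ENNReal.continuous_pow n)
  have h1 := hc.continuousAt (x := 1) |>.eventually
    (lt_mem_nhds (a := (N : ℝ≥0∞)) (by simpa using hF))
  filter_upwards [h1.filter_mono nhdsWithin_le_nhds, eventually_lt_one] with s hs hs1
  exact (hs.trans_le (ENNReal.sum_le_tsum F)).trans_le (green_le_green_self hp hs1 x y)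

/-- Being asymptotically as frequently visited as `y` from `y` propagates along transitions. -/
theorem AsympLE.green_of_step (hp : ∀ x, ∑' y, p x y ≤ 1) {x y z : Ω} (hy : Recurrent p y)
    (hx : AsympLE (green p · y y) (green p · x y)) (hxz : p x z ≠ 0) :
    AsympLE (green p · y y) (green p · z y) := by
  classical
  intro c hc
  have ha1 : p x z ≤ 1 := (ENNReal.le_tsum z).trans (hp x)
  obtain ⟨a, ha⟩ : ∃ a : ℝ≥0, p x z = a :=
    ⟨_, (ENNReal.coe_toNNReal (ne_top_of_le_ne_top ENNReal.one_ne_top ha1)).symm⟩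
  have ha0 : 0 < a := by
    rw [pos_iff_ne_zero]; rintro rfl; exact hxz (by simpa using ha)
  have ha1' : a ≤ 1 := by rw [ha] at ha1; exact_mod_cast ha1
  obtain ⟨e, he⟩ : ∃ e : ℝ≥0, c + e = 1 := ⟨1 - c, add_tsub_cancel_of_le hc.le⟩
  have he0 : 0 < e := by
    rw [pos_iff_ne_zero]; rintro rfl; exact hc.ne (by simpa using he)
  have he1 : e ≤ 1 := he ▸ le_add_self
  set b : ℝ≥0 := a * e / 2 with hb
  have hb0 : 0 < b := by positivity
  have hb1 : b ≤ 1 := by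
    have : a * e ≤ 1 := mul_le_one' ha1' he1
    rw [hb, div_le_iff₀ (by norm_num)]
    exact this.trans (by norm_num)
  have hc' : (1 - b : ℝ≥0) < 1 := tsub_lt_self one_pos hb0
  filter_upwards [hx _ hc', eventually_lt_one,
    ENNReal.tendsto_nhds_top_iff_nnreal.1 hy b⁻¹] with s h1 hs h2
  have hle : ∀ w, green p s w y ≤ green p s y y := fun w => green_le_green_self hp hs w y
  have main : green p s x y + a * green p s y y ≤ 1 + green p s y y + a * green p s z y := by
    have e1 : green p s x y ≤ 1 + ∑' w, p x w * green p s w y := by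
      rw [green_eq]
      gcongr
      · exact stepPow_le_one hp 0 x y
      · exact mul_le_of_le_one_left' hs.le
    have e2 : ∑' w, p x w * green p s w y + a * green p s y y
        ≤ green p s y y + a * green p s z y := by
      rw [← ha]
      have f1 : ∀ f : ℝ≥0∞, ∑' w, (if w = z then f else 0) = f := fun f => tsum_ite_eq z fun _ => f
      rw [← f1 (p x z * green p s y y), ← ENNReal.tsum_add]
      calc _ ≤ ∑' w, (p x w * green p s y y + if w = z then p x z * green p s z y else 0) := by
            refine ENNReal.tsum_le_tsum fun w => ?_
            split_ifs with hw
            · subst hw; rw [add_comm]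
            · simp only [add_zero]
              gcongr
              exact hle w
        _ ≤ _ := by
            rw [ENNReal.tsum_add, f1, ENNReal.tsum_mul_right]
            gcongr
            exact mul_le_of_le_one_left' (hp x)
    calc _ ≤ 1 + ∑' w, p x w * green p s w y + a * green p s y y := by gcongr
      _ ≤ _ := by rw [add_assoc, add_assoc]; gcongr
  obtain ⟨D, hD⟩ : ∃ D : ℝ≥0, green p s y y = D :=
    ⟨_, (ENNReal.coe_toNNReal (green_ne_top hp hs y y)).symm⟩
  obtain ⟨X, hX⟩ : ∃ D : ℝ≥0, green p s x y = D :=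
    ⟨_, (ENNReal.coe_toNNReal (green_ne_top hp hs x y)).symm⟩
  obtain ⟨Z, hZ⟩ : ∃ D : ℝ≥0, green p s z y = D :=
    ⟨_, (ENNReal.coe_toNNReal (green_ne_top hp hs z y)).symm⟩
  rw [hD, hX, hZ] at main
  rw [hD, hX] at h1
  rw [hD] at h2
  rw [hD, hZ]
  norm_cast at main h1 h2 ⊢
  have h2' : 1 ≤ b * D := by
    have := (inv_lt_iff_one_lt_mul₀' hb0).1 h2
    exact this.le
  rw [← NNReal.coe_le_coe] at main h1 h2' ⊢
  rw [NNReal.coe_mul, NNReal.coe_sub hb1] at h1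
  push_cast [hb] at main h1 h2' ⊢
  have he' : (c : ℝ) + e = 1 := by exact_mod_cast he
  have ha0' : (0 : ℝ) < a := ha0
  have he'' : (e : ℝ) = 1 - c := by linarith
  rw [he''] at h1 h2'
  refine le_of_mul_le_mul_left ?_ ha0'
  nlinarith

theorem AsympLE.refl (f : ℝ≥0∞ → ℝ≥0∞) : AsympLE f f := fun c hc =>
  Eventually.of_forall fun _ => mul_le_of_le_one_left' (by exact_mod_cast hc.le)

theorem AsympLE.green_of_stepPow (hp : ∀ x, ∑' y, p x y ≤ 1) {x y z : Ω} (hy : Recurrent p y)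
    (hx : AsympLE (green p · y y) (green p · x y)) (n : ℕ) (hxz : stepPow p n x z ≠ 0) :
    AsympLE (green p · y y) (green p · z y) := by
  induction n generalizing z with
  | zero =>
    rcases eq_or_ne x z with rfl | h
    · exact hx
    · exact absurd (stepPow_zero_of_ne p h) hxz
  | succ n ih =>
    rw [stepPow_succ, Ne, ENNReal.tsum_eq_zero, not_forall] at hxz
    obtain ⟨w, hw⟩ := hxz
    exact (ih (left_ne_zero_of_mul hw)).green_of_step hp hy (right_ne_zero_of_mul hw)

theorem Recurrent.of_asympLE (hp' : ∀ y, ∑' x, p x y ≤ 1) {y z : Ω} (hy : Recurrent p y)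
    (hz : AsympLE (green p · y y) (green p · z y)) : Recurrent p z :=
  (hz.mono fun _ hs => green_le_green_self_left hp' hs z y).tendsto_top hy

theorem Recurrent.of_step (hp : ∀ x, ∑' y, p x y ≤ 1) (hp' : ∀ y, ∑' x, p x y ≤ 1) {y z : Ω}
    (hy : Recurrent p y) (hz : p y z ≠ 0) : Recurrent p z :=
  hy.of_asympLE hp' ((AsympLE.refl _).green_of_step hp hy hz)

/-- The converse of `AsympLE.green_of_step`: propagation against the transitions. -/
theorem AsympLE.green_of_step_symm (hp : ∀ x, ∑' y, p x y ≤ 1) (hp' : ∀ y, ∑' x, p x y ≤ 1)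
    {x y z : Ω} (hy : Recurrent p y) (hx : AsympLE (green p · y y) (green p · x y))
    (hzx : p z x ≠ 0) : AsympLE (green p · y y) (green p · z y) := by
  have hxr : Recurrent p x := hy.of_asympLE hp' hx
  have hzr : Recurrent p z := recurrent_swap_iff.1
    (Recurrent.of_step (p := Function.swap p) hp' hp (recurrent_swap_iff.2 hxr) hzx)
  have h1 : AsympLE (green p · z z) (green p · x z) :=
    (AsympLE.refl _).green_of_step hp hzr hzx
  obtain ⟨s, hs⟩ := ((h1 2⁻¹ (NNReal.inv_lt_one_iff (by norm_num) |>.2 (by norm_num)))).exists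
  have hpos : green p s x z ≠ 0 := by
    intro h0
    beta_reduce at hs
    rw [h0, nonpos_iff_eq_zero, mul_eq_zero] at hs
    rcases hs with hs | hs
    · simp at hs
    · exact absurd (hs ▸ one_le_green_self p s z) (by simp)
  rw [green, Ne, ENNReal.tsum_eq_zero, not_forall] at hpos
  obtain ⟨n, hn⟩ := hpos
  exact hx.green_of_stepPow hp hy n (right_ne_zero_of_mul hn)

end Potential

section GroupWalk

open scoped ENNReal NNReal

variable {P : Type*} [Group P] [MeasurableSpace P] {μ : Measure P} {Ω : Type*} [MulAction P Ω]

/-- The transition matrix of the chain `R_n⁻¹ • x` on a set with a group action. -/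
noncomputable def stepKernel (Ω : Type*) [MulAction P Ω] (μ : Measure P) (x y : Ω) : ℝ≥0∞ :=
  μ {g | g • y = x}

theorem tsum_stepKernel_left_le [Countable Ω] [IsProbabilityMeasure μ]
    (hm : ∀ x y : Ω, MeasurableSet {g : P | g • y = x}) (y : Ω) :
    ∑' x, stepKernel Ω μ x y ≤ 1 := by
  unfold stepKernel
  rw [← measure_iUnion _ fun x => hm x y]
  · exact prob_le_one
  · intro a b hab
    exact Set.disjoint_left.2 fun g h1 h2 => hab (h1.symm.trans h2)

theorem tsum_stepKernel_right_le [Countable Ω] [IsProbabilityMeasure μ]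
    (hm : ∀ x y : Ω, MeasurableSet {g : P | g • y = x}) (x : Ω) :
    ∑' y, stepKernel Ω μ x y ≤ 1 := by
  unfold stepKernel
  rw [← measure_iUnion _ fun y => hm x y]
  · exact prob_le_one
  · intro a b hab
    exact Set.disjoint_left.2 fun g h1 h2 =>
      hab (smul_left_cancel g ((show g • a = x from h1).trans (show g • b = x from h2).symm))

omit [MeasurableSpace P] in
theorem setOf_rightWalk_succ_smul_eq (n : ℕ) (x y : Ω) :
    {ξ : ℕ → P | rightWalk ξ (n + 1) • y = x} =
      ⋃ w, {ξ : ℕ → P | rightWalk ξ n • w = x} ∩ {ξ | ξ n • y = w} := by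
  ext ξ
  simp [rightWalk, mul_smul]

theorem measurableSet_past_rightWalk [Countable Ω]
    (hm : ∀ x y : Ω, MeasurableSet {g : P | g • y = x}) (n : ℕ) (x y : Ω) :
    MeasurableSet[⨆ i ∈ Set.Iio n, MeasurableSpace.comap (fun ξ : ℕ → P => ξ i) inferInstance]
      {ξ : ℕ → P | rightWalk ξ n • y = x} := by
  induction n generalizing y with
  | zero => simp only [rightWalk]; exact MeasurableSet.const _
  | succ n ih =>
    rw [setOf_rightWalk_succ_smul_eq]
    refine MeasurableSet.iUnion fun w => MeasurableSet.inter ?_ ?_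
    · refine MeasurableSpace.le_def.1 ?_ _ (ih w)
      exact biSup_mono fun i (hi : i < n) => Nat.lt_succ_of_lt hi
    · refine MeasurableSpace.le_def.1 (le_biSup (fun i => MeasurableSpace.comap
        (fun ξ : ℕ → P => ξ i) inferInstance) (show n ∈ Set.Iio (n + 1) from Nat.lt_succ_self n)) _ ?_
      exact ⟨_, hm w y, rfl⟩

theorem measurableSet_rightWalk [Countable Ω]
    (hm : ∀ x y : Ω, MeasurableSet {g : P | g • y = x}) (n : ℕ) (x y : Ω) :
    MeasurableSet {ξ : ℕ → P | rightWalk ξ n • y = x} := by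
  refine MeasurableSpace.le_def.1 ?_ _ (measurableSet_past_rightWalk hm n x y)
  exact iSup₂_le fun i _ => (measurable_pi_apply i).comap_le

/-- The distribution of the random walk, evaluated on the sets `{g | g • y = x}`. -/
theorem measure_rightWalk_eq_stepPow [Countable Ω] [IsProbabilityMeasure μ]
    (hm : ∀ x y : Ω, MeasurableSet {g : P | g • y = x}) (n : ℕ) (x y : Ω) :
    Measure.infinitePi (fun _ : ℕ => μ) {ξ | rightWalk ξ n • y = x} =
      stepPow (stepKernel Ω μ) n x y := by
  induction n generalizing y with
  | zero =>
    rcases eq_or_ne x y with rfl | h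
    · simp [rightWalk, stepPow_zero_self]
    · simp [rightWalk, stepPow_zero_of_ne _ h, h.symm]
  | succ n ih =>
    have hind : ProbabilityTheory.iIndepFun (fun (i : ℕ) (ξ : ℕ → P) => ξ i)
        (Measure.infinitePi fun _ : ℕ => μ) :=
      ProbabilityTheory.iIndepFun_infinitePi (X := fun _ g => g) fun _ => measurable_id
    have hind2 := ProbabilityTheory.indep_iSup_of_disjoint
      (fun i => (measurable_pi_apply i).comap_le) hind
      (S := Set.Iio n) (T := {n}) (by simp)
    rw [setOf_rightWalk_succ_smul_eq, measure_iUnion, stepPow_succ]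
    · refine tsum_congr fun w => ?_
      rw [ProbabilityTheory.Indep_iff] at hind2
      rw [hind2 _ _ (measurableSet_past_rightWalk hm n x w), ih, stepKernel]
      · congr 1
        conv_rhs => rw [← Measure.infinitePi_map_eval (fun _ : ℕ => μ) n,
          Measure.map_apply (measurable_pi_apply n) (hm w y)]
        rfl
      · rw [iSup_singleton]
        exact ⟨_, hm w y, rfl⟩
    · intro a b hab
      exact Set.disjoint_left.2 fun ξ h1 h2 => hab (h1.2.symm.trans h2.2)
    · intro w
      exact (measurableSet_rightWalk hm n x w).inter ((hm w y).preimage (measurable_pi_apply n))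

variable [TopologicalSpace P] [OpensMeasurableSpace P]

/-- If the Green function of the action on `Ω` is finite, then the walk is transient. -/
theorem isTransient_of_tsum_stepPow_ne_top [Countable Ω] [IsProbabilityMeasure μ]
    (ho : ∀ x y : Ω, IsOpen {g : P | g • y = x}) (y : Ω)
    (h : ∀ x, ∑' n, stepPow (stepKernel Ω μ) n x y ≠ ∞) : IsTransient μ := by
  have hm : ∀ x y : Ω, MeasurableSet {g : P | g • y = x} := fun x y => (ho x y).measurableSet
  have hae : ∀ᵐ ξ ∂(Measure.infinitePi fun _ : ℕ => μ), ∀ x : Ω,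
      ∀ᶠ n in atTop, rightWalk ξ n • y ≠ x := by
    rw [ae_all_iff]
    intro x
    have := ae_finite_setOfPred_mem (μ := Measure.infinitePi fun _ : ℕ => μ)
      (s := fun n => {ξ | rightWalk ξ n • y = x})
      (by simpa only [measure_rightWalk_eq_stepPow hm] using h x)
    filter_upwards [this] with ξ hξ
    rw [← Nat.cofinite_eq_atTop]
    exact hξ.compl_mem_cofinite
  filter_upwards [hae] with ξ hξ E hE
  obtain ⟨F, hF⟩ := hE.elim_finite_subcover (fun x : Ω => {g : P | g • y = x})
    (fun x => ho x y) fun g _ => Set.mem_iUnion.2 ⟨g • y, rfl⟩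
  filter_upwards [(F.eventually_all).2 fun x _ => hξ x] with n hn hmem
  obtain ⟨x, hx, hgx⟩ := Set.mem_iUnion₂.1 (hF hmem)
  exact hn x hx hgx

theorem isTransient_of_not_recurrent [Countable Ω] [IsProbabilityMeasure μ]
    (ho : ∀ x y : Ω, IsOpen {g : P | g • y = x}) (y : Ω)
    (h : ¬ Recurrent (stepKernel Ω μ) y) : IsTransient μ := by
  have hm : ∀ x y : Ω, MeasurableSet {g : P | g • y = x} := fun x y => (ho x y).measurableSet
  have hr := tsum_stepKernel_right_le (μ := μ) hm
  refine isTransient_of_tsum_stepPow_ne_top ho y fun x hx => h ?_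
  exact recurrent_of_tsum_eq_top hr hx

variable [IsTopologicalGroup P]

omit [OpensMeasurableSpace P] in
theorem smul_mem_of_mem_closedGroupGenerated (ho : ∀ x y : Ω, IsOpen {g : P | g • y = x})
    {S : Set Ω} (h1 : ∀ x ∈ S, ∀ z, stepKernel Ω μ x z ≠ 0 → z ∈ S)
    (h2 : ∀ x ∈ S, ∀ z, stepKernel Ω μ z x ≠ 0 → z ∈ S) {g : P}
    (hg : g ∈ closedGroupGenerated μ) {x : Ω} (hx : x ∈ S) : g • x ∈ S := by
  have hpos : ∀ g ∈ μ.support, ∀ x : Ω, stepKernel Ω μ (g • x) x ≠ 0 := fun g hg x =>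
    (Measure.mem_support_iff_forall g |>.1 hg _ ((ho (g • x) x).mem_nhds rfl)).ne'
  have hcl : ∀ g ∈ Subgroup.closure μ.support, ∀ x : Ω, g • x ∈ S ↔ x ∈ S := by
    intro g hg
    induction hg using Subgroup.closure_induction with
    | mem g hg => exact fun x => ⟨fun h => h1 _ h _ (hpos g hg x), fun h => h2 _ h _ (hpos g hg x)⟩
    | one => simp
    | mul a b _ _ ha hb => intro x; rw [mul_smul, ha, hb]
    | inv a _ ha => intro x; rw [← ha, smul_inv_smul]
  have hg' : g ∈ closure (Subgroup.closure μ.support : Set P) := hg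
  obtain ⟨g', hg1, hg2⟩ := mem_closure_iff.1 hg' _ (ho (g • x) x) rfl
  rw [← show g' • x = g • x from hg1]
  exact (hcl g' hg2 x).2 hx

/-- From a recurrent state, every point of the orbit is asymptotically equally often visited. -/
theorem asympLE_green_smul [Countable Ω] [IsProbabilityMeasure μ]
    (ho : ∀ x y : Ω, IsOpen {g : P | g • y = x}) {y : Ω} (hy : Recurrent (stepKernel Ω μ) y)
    {g : P} (hg : g ∈ closedGroupGenerated μ) :
    AsympLE (green (stepKernel Ω μ) · y y) (green (stepKernel Ω μ) · (g • y) y) := by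
  have hm : ∀ x y : Ω, MeasurableSet {g : P | g • y = x} := fun x y => (ho x y).measurableSet
  have hr := tsum_stepKernel_right_le (μ := μ) hm
  have hl := tsum_stepKernel_left_le (μ := μ) hm
  refine smul_mem_of_mem_closedGroupGenerated ho
    (S := {z | AsympLE (green (stepKernel Ω μ) · y y) (green (stepKernel Ω μ) · z y)})
    (fun x hx z hz => hx.green_of_step hr hy hz)
    (fun x hx z hz => hx.green_of_step_symm hr hl hy hz) hg (AsympLE.refl _)

omit [OpensMeasurableSpace P] in
theorem exists_smul_eq_of_stepPow_ne_zero [HereditarilyLindelofSpace P] (n : ℕ) {x y : Ω}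
    (h : stepPow (stepKernel Ω μ) n x y ≠ 0) : ∃ g ∈ closedGroupGenerated μ, g • y = x := by
  induction n generalizing y with
  | zero =>
    rcases eq_or_ne x y with rfl | hne
    · exact ⟨1, one_mem _, one_smul _ _⟩
    · exact absurd (stepPow_zero_of_ne _ hne) h
  | succ n ih =>
    rw [stepPow_succ, Ne, ENNReal.tsum_eq_zero, not_forall] at h
    obtain ⟨w, hw⟩ := h
    obtain ⟨g, hg, hgw⟩ := ih (left_ne_zero_of_mul hw)
    obtain ⟨g', hg', hs⟩ := Measure.nonempty_inter_support_of_pos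
      (pos_iff_ne_zero.2 (right_ne_zero_of_mul hw))
    refine ⟨g * g', mul_mem hg (Subgroup.le_topologicalClosure _ (Subgroup.subset_closure hs)), ?_⟩
    rw [mul_smul, show g' • y = w from hg', hgw]

omit [MeasurableSpace P] [OpensMeasurableSpace P] [IsTopologicalGroup P] in
theorem isOpen_setOf_smul_prod_eq (ho : ∀ x y : Ω, IsOpen {g : P | g • y = x}) (x y : Ω × Ω) :
    IsOpen {g : P | g • y = x} := by
  have : {g : P | g • y = x} = {g | g • y.1 = x.1} ∩ {g | g • y.2 = x.2} := by
    ext g; simp [Prod.ext_iff]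
  rw [this]
  exact (ho _ _).inter (ho _ _)

theorem green_fst_eq_green_pair [Countable Ω] [IsProbabilityMeasure μ] [HereditarilyLindelofSpace P]
    (ho : ∀ x y : Ω, IsOpen {g : P | g • y = x}) {x y : Ω}
    (h : ∀ g ∈ closedGroupGenerated μ, g • x = x → g • y = y) (s : ℝ≥0∞) :
    green (stepKernel Ω μ) s x x = green (stepKernel (Ω × Ω) μ) s (x, y) (x, y) := by
  have ho' := isOpen_setOf_smul_prod_eq ho
  have hm := fun x y : Ω => (ho x y).measurableSet
  have hm' := fun x y : Ω × Ω => (ho' x y).measurableSet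
  refine tsum_congr fun n => congrArg _ ?_
  have hU : {ξ : ℕ → P | rightWalk ξ n • x = x} =
      ⋃ z, {ξ : ℕ → P | rightWalk ξ n • (x, y) = (x, z)} := by
    ext ξ; simp
  rw [← measure_rightWalk_eq_stepPow hm, hU, measure_iUnion]
  · simp_rw [measure_rightWalk_eq_stepPow hm']
    refine tsum_eq_single y fun z hz => ?_
    by_contra hne
    obtain ⟨g, hg, hgx⟩ := exists_smul_eq_of_stepPow_ne_zero n hne
    rw [Prod.smul_mk, Prod.mk.injEq] at hgx
    exact hz (hgx.2.symm.trans (h g hg hgx.1))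
  · intro a b hab
    exact Set.disjoint_left.2 fun ξ h1 h2 => hab (congrArg Prod.snd (h1.symm.trans h2))
  · exact fun z => measurableSet_rightWalk hm' n _ _

omit [IsTopologicalGroup P] in
theorem add_green_pair_le [Countable Ω] [IsProbabilityMeasure μ]
    (ho : ∀ x y : Ω, IsOpen {g : P | g • y = x}) {x x' x₀ y y₀ : Ω} (hx : x ≠ x') (s : ℝ≥0∞) :
    green (stepKernel (Ω × Ω) μ) s (x, y) (x₀, y₀) + green (stepKernel (Ω × Ω) μ) s (x', y) (x₀, y₀)
      ≤ green (stepKernel Ω μ) s y y₀ := by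
  have ho' := isOpen_setOf_smul_prod_eq ho
  have hm := fun x y : Ω => (ho x y).measurableSet
  have hm' := fun x y : Ω × Ω => (ho' x y).measurableSet
  simp_rw [green]
  rw [← ENNReal.tsum_add]
  refine ENNReal.tsum_le_tsum fun n => ?_
  rw [← mul_add]
  gcongr
  rw [← measure_rightWalk_eq_stepPow hm, ← measure_rightWalk_eq_stepPow hm',
    ← measure_rightWalk_eq_stepPow hm', ← measure_union _ (measurableSet_rightWalk hm' n _ _)]
  · refine measure_mono (Set.union_subset ?_ ?_) <;>
      exact fun ξ hξ => congrArg Prod.snd hξ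
  · exact Set.disjoint_left.2 fun ξ h1 h2 => hx (congrArg Prod.fst (h1.symm.trans h2))

/-- A recurrent walk forces the group it generates to be unimodular: a point stabiliser cannot
fix a point of the orbit whose own stabiliser moves the original point. -/
theorem isTransient_of_stabilizer [Countable Ω] [IsProbabilityMeasure μ]
    [HereditarilyLindelofSpace P]
    (ho : ∀ x y : Ω, IsOpen {g : P | g • y = x}) {x : Ω} {γ κ : P}
    (hγ : γ ∈ closedGroupGenerated μ) (hκ : κ ∈ closedGroupGenerated μ)
    (h : ∀ g ∈ closedGroupGenerated μ, g • x = x → g • γ • x = γ • x)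
    (hκy : κ • γ • x = γ • x) (hκx : κ • x ≠ x) : IsTransient μ := by
  have ho' := isOpen_setOf_smul_prod_eq ho
  have hm := fun x y : Ω => (ho x y).measurableSet
  have hr := tsum_stepKernel_right_le (μ := μ) hm
  have hl := tsum_stepKernel_left_le (μ := μ) hm
  by_contra hnt
  have hx : Recurrent (stepKernel Ω μ) x := by
    by_contra hx
    exact hnt (isTransient_of_not_recurrent ho x hx)
  have hpair := green_fst_eq_green_pair ho h
  have hπ : Recurrent (stepKernel (Ω × Ω) μ) (x, γ • x) := by
    simpa only [Recurrent, hpair] using hx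
  have hy : Recurrent (stepKernel Ω μ) (γ • x) := hx.of_asympLE hl (asympLE_green_smul ho hx hγ)
  have h1 := asympLE_green_smul ho' hπ hκ
  have h2 := asympLE_green_smul ho hy (inv_mem hγ)
  rw [inv_smul_smul] at h2
  have hc : (3 / 4 : ℝ≥0) < 1 := by rw [div_lt_one (by norm_num)]; norm_num
  obtain ⟨s, e1, e2, hs⟩ := ((h1 _ hc).and ((h2 _ hc).and eventually_lt_one)).exists
  have e3 := add_green_pair_le (μ := μ) ho (x := x) (x' := κ • x) (x₀ := x) (y := γ • x)
    (y₀ := γ • x) hκx.symm s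
  rw [Prod.smul_mk, hκy] at e1
  have e4 := e2.trans (green_le_green_self_left hl hs x (γ • x))
  beta_reduce at e1 e4
  rw [← hpair s] at e1 e3
  have e5 := one_le_green_self (stepKernel Ω μ) s x
  have e6 := green_ne_top hr hs x x
  generalize green (stepKernel Ω μ) s x x = D at *
  have e7 : (3 / 4 : ℝ≥0) * (D + (3 / 4 : ℝ≥0) * D) ≤ D := by
    refine le_trans ?_ e4
    gcongr
    exact le_trans (by gcongr) e3
  lift D to ℝ≥0 using e6
  norm_cast at e5 e7
  rw [← NNReal.coe_le_coe] at e5 e7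
  push_cast at e5 e7
  linarith

end GroupWalk

universe u

section Trees

variable {V : Type u} {G : SimpleGraph V}

theorem IsHomogeneousTree.countable {d : ℕ} (hG : IsHomogeneousTree G d) : Countable V := by
  obtain ⟨o⟩ := hG.isTree.connected.nonempty
  have h : ∀ n : ℕ, {v : V | ∃ p : G.Walk v o, p.length = n}.Countable := by
    intro n
    induction n with
    | zero =>
      refine (Set.countable_singleton o).mono ?_
      rintro v ⟨p, hp⟩
      exact SimpleGraph.Walk.eq_of_length_eq_zero hp
    | succ n ih =>
      have hfin : ∀ w, (G.neighborSet w).Countable := fun w =>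
        (Set.finite_of_encard_eq_coe (hG.encard_neighborSet w)).countable
      refine (ih.biUnion fun w _ => hfin w).mono ?_
      rintro v ⟨p, hp⟩
      cases p with
      | nil => simp at hp
      | cons hvw q =>
        rw [SimpleGraph.Walk.length_cons] at hp
        exact Set.mem_biUnion (x := _) ⟨q, by omega⟩ hvw.symm
  refine Set.countable_univ_iff.1 ((Set.countable_iUnion h).mono fun v _ => ?_)
  obtain ⟨p⟩ := hG.isTree.connected.preconnected v o
  exact Set.mem_iUnion.2 ⟨p.length, p, rfl⟩

theorem toEnd_eq_iff (hG : G.IsTree) {r s : Ray G} :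
    r.toEnd hG = s.toEnd hG ↔ RayEquiv r s :=
  ⟨fun h => Quotient.exact (s := raySetoid hG) h, fun h => Quotient.sound (s := raySetoid hG) h⟩

theorem Ray.eq_of_toEnd_eq (hG : G.IsTree) {r s : Ray G} (h0 : r 0 = s 0)
    (h : r.toEnd hG = s.toEnd hG) (n : ℕ) : r n = s n := by
  obtain ⟨a, b, hab⟩ := ((toEnd_eq_iff hG).1 h).exists_shift hG
  have e : a = b := by
    have h1 := r.dist_zero hG a
    have h2 := s.dist_zero hG b
    rw [← h0, ← (show r a = s b from hab 0), h1] at h2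
    exact_mod_cast h2
  subst e
  rcases le_total a n with hn | hn
  · obtain ⟨i, rfl⟩ := Nat.exists_eq_add_of_le hn
    exact hab i
  · obtain ⟨i, rfl⟩ := Nat.exists_eq_add_of_le hn
    have h3 : r (n + i) = s (n + i) := hab 0
    refine geodesic_unique hG (x := r 0) (y := r (n + i)) ?_ ?_ ?_
    · rw [r.dist_zero hG, h0, s.dist_zero hG]
    · rw [r.dist_add hG, h3, s.dist_add hG]
    · rw [r.dist_zero hG, r.dist_add hG, r.dist_zero hG]

/-- An automorphism fixing `ω` and a vertex of the ray from `o` to `ω` is horocyclic. -/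
theorem busemann_eq_zero_of_fixed (hG : G.IsTree) {ω : Ends hG} {o : V} {α : G ≃g G}
    (hα : α • ω = ω) {p : ℕ} (hp : α (rayFrom hG o ω p) = rayFrom hG o ω p) :
    busemann hG ω o (α o) = 0 := by
  classical
  set r := rayFrom hG o ω
  set s := rayFrom hG (α o) ω
  have hr : r.toEnd hG = ω := toEnd_rayFrom hG o ω
  have hr0 : r 0 = o := rayFrom_zero hG o ω
  have hs : ∀ n, s n = α (r n) := by
    intro n
    refine Ray.eq_of_toEnd_eq hG (r := s) (s := r.map α) ?_ ?_ n
    · change rayFrom hG (α o) ω 0 = α (rayFrom hG o ω 0)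
      rw [rayFrom_zero, rayFrom_zero]
    · rw [← smul_toEnd, hr, hα]
      exact toEnd_rayFrom hG (α o) ω
  obtain ⟨b, hb⟩ := Nat.find_spec (exists_common_vertex hG (α o) o ω)
  set a := Nat.find (exists_common_vertex hG (α o) o ω)
  have hc : firstCommonVertex hG ω (α o) o = s a := rfl
  have hb' : r b = s a := hb
  have htail : ∀ i, r (b + i) = s (a + i) := by
    intro i
    refine Ray.eq_of_toEnd_eq hG (r := r.shift b) (s := s.shift a) hb' ?_ i
    have sh : ∀ (t : Ray G) (k : ℕ), (t.shift k).toEnd hG = t.toEnd hG := fun t k =>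
      (toEnd_eq_iff hG).2 (rayEquiv_of_shift hG (m := 0) (n := k) fun i => by simp [Ray.shift])
    rw [sh, sh, hr]
    exact (toEnd_rayFrom hG (α o) ω).symm
  have hfix : ∀ i, α (r (p + i)) = r (p + i) := by
    intro i
    have sh : (r.shift p).toEnd hG = ω := hr ▸
      (toEnd_eq_iff hG).2 (rayEquiv_of_shift hG (m := 0) (n := p) fun i => by simp [Ray.shift])
    refine Ray.eq_of_toEnd_eq hG (r := (r.shift p).map α) (s := r.shift p) hp ?_ i
    rw [← smul_toEnd, sh, hα]
  have hab : b = a := by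
    have h1 := htail p
    rw [hs, add_comm a p, hfix] at h1
    have := r.injective hG h1
    omega
  have d1 : G.dist (α o) (s a) = a := by
    rw [show α o = s 0 from (rayFrom_zero hG (α o) ω).symm]; exact s.dist_zero hG a
  have d2 : G.dist o (s a) = b := by
    rw [← hb', ← hr0]; exact r.dist_zero hG b
  rw [busemann, hc, d1, d2, hab, sub_self]

/-- A bi-infinite geodesic, directed towards the end `ω`. -/
structure IsLine (hG : G.IsTree) (ω : Ends hG) (x : ℤ → V) : Prop where
  adj : ∀ n, G.Adj (x n) (x (n + 1))
  ne_backtrack : ∀ n, x n ≠ x (n + 2)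
  toEnd : ∀ r : Ray G, (∀ n : ℕ, r n = x n) → r.toEnd hG = ω

namespace IsLine

variable {hG : G.IsTree} {ω : Ends hG} {x : ℤ → V}

/-- The part of a line from the index `a` on. -/
def rayUp (hx : IsLine hG ω x) (a : ℤ) : Ray G where
  toFun n := x (a + n)
  adj n := by push_cast; rw [← add_assoc]; exact hx.adj _
  ne_backtrack n := by push_cast; rw [← add_assoc]; exact hx.ne_backtrack _

/-- The part of a line up to the index `a`, in reversed direction. -/
def rayDown (hx : IsLine hG ω x) (a : ℤ) : Ray G where
  toFun n := x (a - n)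
  adj n := by
    have := (hx.adj (a - (n + 1))).symm
    rw [sub_add_eq_sub_sub, sub_add_cancel] at this
    push_cast
    rwa [sub_add_eq_sub_sub]
  ne_backtrack n := by
    have := (hx.ne_backtrack (a - (n + 2))).symm
    rw [sub_add_eq_sub_sub, sub_add_cancel] at this
    push_cast
    rwa [sub_add_eq_sub_sub]

theorem toEnd_rayUp (hx : IsLine hG ω x) (a : ℤ) : (hx.rayUp a).toEnd hG = ω := by
  refine Eq.trans ?_ (hx.toEnd (hx.rayUp 0) fun n => by simp [rayUp])
  rw [toEnd_eq_iff]
  refine rayEquiv_of_shift hG (m := (-a).toNat) (n := a.toNat) fun i => congrArg x ?_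
  push_cast
  omega

theorem injective (hx : IsLine hG ω x) : Function.Injective x := by
  intro a b h
  wlog hab : a ≤ b generalizing a b
  · exact (this h.symm (by omega)).symm
  have h' : hx.rayUp a 0 = hx.rayUp a (b - a).toNat := by
    change x (a + (0 : ℕ)) = x (a + ((b - a).toNat : ℕ))
    rw [Int.toNat_of_nonneg (by omega)]
    simpa using h
  have := (hx.rayUp a).injective hG h'
  omega

theorem toEnd_rayDown_ne (hx : IsLine hG ω x) : (hx.rayDown 0).toEnd hG ≠ ω := by
  intro h
  replace h := (toEnd_eq_iff hG).1 (h.trans (hx.toEnd_rayUp 0).symm)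
  refine h ((Set.finite_singleton (x 0)).subset ?_)
  rintro _ ⟨⟨a, rfl⟩, ⟨b, hb⟩⟩
  have : (0 : ℤ) + b = 0 - a := hx.injective hb
  change x (0 - a) = x 0
  congr 1
  omega

/-- An automorphism fixing `ω` and a vertex of the line fixes all further vertices of the line. -/
theorem apply_eq_of_le (hx : IsLine hG ω x) {α : G ≃g G} (hα : α • ω = ω) {a b : ℤ} (hab : a ≤ b)
    (ha : α (x a) = x a) : α (x b) = x b := by
  have h := Ray.eq_of_toEnd_eq hG (r := (hx.rayUp a).map α) (s := hx.rayUp a)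
    (by simpa [Ray.map, rayUp] using ha)
    (by rw [← smul_toEnd, hx.toEnd_rayUp, hα]) (b - a).toNat
  change α (x (a + ((b - a).toNat : ℕ))) = x (a + ((b - a).toNat : ℕ)) at h
  rwa [Int.toNat_of_nonneg (by omega), add_sub_cancel] at h

/-- An automorphism fixing `ω` eventually shifts the line. -/
theorem exists_shift (hx : IsLine hG ω x) {α : G ≃g G} (hα : α • ω = ω) :
    ∃ p c : ℤ, ∀ n, p ≤ n → α (x n) = x (n + c) := by
  have h : RayEquiv ((hx.rayUp 0).map α) (hx.rayUp 0) := by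
    rw [← toEnd_eq_iff hG, ← smul_toEnd, hx.toEnd_rayUp, hα]
  obtain ⟨p, q, hpq⟩ := h.exists_shift hG
  refine ⟨p, q - p, fun n hn => ?_⟩
  have h := hpq (n - p).toNat
  change α (x (0 + ((p + (n - p).toNat : ℕ) : ℤ))) = x (0 + ((q + (n - p).toNat : ℕ) : ℤ)) at h
  convert h using 2 <;> [congr 1; skip] <;> push_cast <;> omega

/-- An automorphism shifting the line fixes its lower end. -/
theorem smul_toEnd_rayDown (hx : IsLine hG ω x) {α : G ≃g G} {c : ℤ}
    (hα : ∀ n, α (x n) = x (n + c)) :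
    α • (hx.rayDown 0).toEnd hG = (hx.rayDown 0).toEnd hG := by
  rw [smul_toEnd, toEnd_eq_iff]
  refine rayEquiv_of_shift hG (m := c.toNat) (n := (-c).toNat) fun i => ?_
  change α (x (0 - _)) = x (0 - _)
  rw [hα]
  congr 1
  push_cast
  omega

theorem pow_apply {α : G ≃g G} {m : ℤ} (hα : ∀ n, α (x n) = x (n + m)) (k : ℕ) (n : ℤ) :
    (α ^ k) (x n) = x (n + k * m) := by
  induction k with
  | zero => simp
  | succ k ih =>
    rw [pow_succ', RelIso.mul_apply, ih, hα]
    congr 1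
    push_cast
    ring

end IsLine

/-- The axis of an automorphism which shifts a ray to `ω`. -/
theorem exists_isLine_of_shift (hG : G.IsTree) {ω : Ends hG} {α : G ≃g G} {r : Ray G}
    (hr : r.toEnd hG = ω) {p m : ℕ} (hm : 0 < m) (h : ∀ i, α (r (p + i)) = r (p + m + i)) :
    ∃ x : ℤ → V, IsLine hG ω x ∧ ∀ n, α (x n) = x (n + m) := by
  have hpow : ∀ k i, (α ^ k) (r (p + i)) = r (p + k * m + i) := by
    intro k i
    induction k with
    | zero => simp
    | succ k ih =>
      rw [pow_succ', RelIso.mul_apply, ih, show p + k * m + i = p + (k * m + i) by ring, h]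
      congr 1
      ring
  let x : ℤ → V := fun n => (α ^ n.natAbs)⁻¹ (r (p + (n + n.natAbs * m).toNat))
  have hnn : ∀ (n : ℤ) (k : ℕ), n.natAbs ≤ k → 0 ≤ n + k * m := by
    intro n k hk
    have : (k : ℤ) ≤ k * m := le_mul_of_one_le_right (by positivity) (by exact_mod_cast hm)
    omega
  have hx : ∀ (n : ℤ) (k : ℕ), n.natAbs ≤ k → (α ^ k) (x n) = r (p + (n + k * m).toNat) := by
    intro n k hk
    obtain ⟨j, rfl⟩ := Nat.exists_eq_add_of_le' hk
    rw [pow_add, RelIso.mul_apply]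
    change (α ^ j) ((α ^ n.natAbs) ((α ^ n.natAbs)⁻¹ _)) = _
    rw [RelIso.apply_inv_self, hpow]
    congr 1
    have h1 := hnn n n.natAbs le_rfl
    have h2 := hnn n (j + n.natAbs) hk
    have e : n + ((j + n.natAbs : ℕ) : ℤ) * m = n + n.natAbs * m + (j * m : ℕ) := by
      push_cast
      ring
    rw [e]
    omega
  refine ⟨x, ⟨fun n => ?_, fun n => ?_, fun s hs => ?_⟩, fun n => ?_⟩
  · rw [← (α ^ (n.natAbs + 1)).map_rel_iff, hx _ _ (by omega), hx _ _ (by omega)]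
    have h1 := hnn n (n.natAbs + 1) (by omega)
    rw [show p + (n + 1 + ((n.natAbs + 1 : ℕ) : ℤ) * m).toNat =
      p + (n + ((n.natAbs + 1 : ℕ) : ℤ) * m).toNat + 1 by omega]
    exact r.adj _
  · intro he
    have he' := congrArg (α ^ (n.natAbs + 2)) he
    rw [hx _ _ (by omega), hx _ _ (by omega)] at he'
    have h1 := hnn n (n.natAbs + 2) (by omega)
    have := r.injective hG he'
    omega
  · rw [← hr, toEnd_eq_iff]
    refine rayEquiv_of_shift hG (m := 0) (n := p) fun i => ?_
    rw [hs]
    apply (α ^ i).injective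
    rw [hx _ _ (by omega), hpow]
    congr 1
    have h1 := hnn i i (by omega)
    zify
    rw [zero_add, Int.toNat_of_nonneg h1]
    ring
  · apply (α ^ (n.natAbs + m)).injective
    rw [← RelIso.mul_apply, ← pow_succ, hx _ _ (by omega), hx _ _ (by omega)]
    congr 3
    push_cast
    ring

/-- A group which is not exceptional contains an element shifting a line towards `ω`. -/
theorem exists_isLine_of_not_subset_hor {hG : G.IsTree} {ω : Ends hG} {o : V}
    {Γ : Subgroup (Aff hG ω)} (h : ¬ (Γ : Set (Aff hG ω)) ⊆ Hor hG ω o) :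
    ∃ γ ∈ Γ, ∃ x : ℤ → V, IsLine hG ω x ∧ ∃ m : ℕ, 0 < m ∧ ∀ n, (γ : G ≃g G) (x n) = x (n + m) := by
  obtain ⟨γ, hγ, hγh⟩ := Set.not_subset.1 h
  have hγω : (γ : G ≃g G) • ω = ω := γ.2
  set r := rayFrom hG o ω
  have hr : r.toEnd hG = ω := toEnd_rayFrom hG o ω
  have hequiv : RayEquiv (r.map (γ : G ≃g G)) r := by
    rw [← toEnd_eq_iff hG, ← smul_toEnd, hr, hγω]
  obtain ⟨p, q, hpq⟩ := hequiv.exists_shift hG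
  replace hpq : ∀ i, (γ : G ≃g G) (r (p + i)) = r (q + i) := hpq
  rcases lt_trichotomy p q with hlt | rfl | hlt
  · obtain ⟨x, hx, hγx⟩ := exists_isLine_of_shift hG hr (α := (γ : G ≃g G)) (p := p) (m := q - p)
      (by omega) fun i => by rw [hpq]; congr 1; omega
    exact ⟨γ, hγ, x, hx, q - p, by omega, hγx⟩
  · exact absurd (busemann_eq_zero_of_fixed hG hγω (hpq 0)) hγh
  · obtain ⟨x, hx, hγx⟩ := exists_isLine_of_shift hG hr (α := (γ : G ≃g G)⁻¹) (p := q)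
      (m := p - q) (by omega) fun i => by
        rw [← hpq, RelIso.inv_apply_self]; congr 1; omega
    exact ⟨γ⁻¹, inv_mem hγ, x, hx, p - q, by omega, hγx⟩

/-- A group which is not exceptional is not unimodular on orbits: some vertex stabiliser fixes a
vertex of the same orbit whose own stabiliser does not fix the first one. -/
theorem exists_stabilizer_of_not_exceptional {hG : G.IsTree} {ω : Ends hG} {o : V}
    {Γ : Subgroup (Aff hG ω)} (h : ¬ Exceptional o Γ) :
    ∃ v : V, ∃ γ ∈ Γ, ∃ κ ∈ Γ,
      (∀ α ∈ Γ, (α : G ≃g G) v = v → (α : G ≃g G) ((γ : G ≃g G) v) = (γ : G ≃g G) v) ∧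
      (κ : G ≃g G) ((γ : G ≃g G) v) = (γ : G ≃g G) v ∧ (κ : G ≃g G) v ≠ v := by
  rw [Exceptional, not_or] at h
  obtain ⟨γ, hγ, x, hx, m, hm, hγx⟩ := exists_isLine_of_not_subset_hor h.1
  obtain ⟨δ, hδ, hδξ⟩ : ∃ δ ∈ Γ, (δ : G ≃g G) • (hx.rayDown 0).toEnd hG ≠ (hx.rayDown 0).toEnd hG := by
    by_contra hc
    push Not at hc
    exact h.2 ⟨_, hx.toEnd_rayDown_ne, hc⟩
  obtain ⟨p, c, hδx⟩ := hx.exists_shift (α := (δ : G ≃g G)) δ.2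
  obtain ⟨i, hi⟩ : ∃ i, (δ : G ≃g G) (x i) ≠ x (i + c) := by
    by_contra hc
    push Not at hc
    exact hδξ (hx.smul_toEnd_rayDown hc)
  set k : ℕ := p.natAbs + i.natAbs
  have hk : p ≤ i + k * m := by
    have : (k : ℤ) ≤ k * m := le_mul_of_one_le_right (by positivity) (by exact_mod_cast hm)
    omega
  have hpow := IsLine.pow_apply hγx k
  refine ⟨x i, γ ^ k, pow_mem hγ k, (γ ^ k)⁻¹ * δ⁻¹ * γ ^ k * δ, by
    exact mul_mem (mul_mem (mul_mem (inv_mem (pow_mem hγ k)) (inv_mem hδ)) (pow_mem hγ k)) hδ,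
    ?_, ?_, ?_⟩
  · intro α _ hα
    simp only [Subgroup.coe_pow, hpow]
    exact hx.apply_eq_of_le α.2 (le_add_of_nonneg_right (by positivity)) hα
  · simp only [Subgroup.coe_mul, Subgroup.coe_inv, Subgroup.coe_pow, RelIso.mul_apply]
    rw [hpow, hδx _ hk, hpow, show i + k * m + c + k * m = i + k * m + k * m + c by ring,
      ← hδx _ (hk.trans (le_add_of_nonneg_right (by positivity))), RelIso.inv_apply_self, ← hpow,
      RelIso.inv_apply_self]
  · simp only [Subgroup.coe_mul, Subgroup.coe_inv, Subgroup.coe_pow, RelIso.mul_apply]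
    intro he
    have he1 := congrArg ((γ : G ≃g G) ^ k) he
    rw [RelIso.apply_inv_self] at he1
    have he2 := congrArg (δ : G ≃g G) he1
    rw [RelIso.apply_inv_self, hpow, hδx _ hk, show i + k * m + c = i + c + k * m by ring,
      ← hpow] at he2
    exact hi (((γ : G ≃g G) ^ k).injective he2)

end Trees

section Trees

variable {V : Type u} {G : SimpleGraph V}

theorem isOpen_setOf_apply_eq (x y : V) : IsOpen {α : G ≃g G | α y = x} := by
  rw [isOpen_iff_mem_nhds]
  intro α hα
  refine (nhds_aut α).mem_iff.2 ⟨{y}, Set.finite_singleton y, fun β hβ => ?_⟩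
  exact (hβ y rfl).trans hα

theorem secondCountableTopology_aut [Countable V] : SecondCountableTopology (G ≃g G) := by
  let _ : TopologicalSpace V := ⊥
  have : DiscreteTopology V := ⟨rfl⟩
  exact (⟨rfl⟩ : IsInducing fun α : G ≃g G => (α : V → V)).secondCountableTopology

end Trees

section Product

variable {ι : Type*} {W : ι → Type u} {T : ∀ i, SimpleGraph (W i)} {hT : ∀ i, (T i).IsTree}
  {ω : ∀ i, Ends (hT i)}

/-- The action of the product of the affine groups on the vertices of one of the trees. -/
abbrev vertexAction (hT : ∀ i, (T i).IsTree) (ω : ∀ i, Ends (hT i)) (j : ι) :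
    MulAction (AffProd hT ω) (W j) where
  smul g v := (g j : T j ≃g T j) v
  one_smul _ := rfl
  mul_smul _ _ _ := rfl

theorem isTransient_of_not_fullyExceptional [Countable ι] [∀ i, Countable (W i)] (o : ∀ i, W i)
    [MeasurableSpace (AffProd hT ω)] [BorelSpace (AffProd hT ω)] (μ : Measure (AffProd hT ω))
    [IsProbabilityMeasure μ] (hμ : ¬ FullyExceptional o (closedGroupGenerated μ)) :
    IsTransient μ := by
  obtain ⟨j, hj⟩ := not_forall.1 hμ
  obtain ⟨v, _, ⟨γ, hγ, rfl⟩, _, ⟨κ, hκ, rfl⟩, h1, h2, h3⟩ := exists_stabilizer_of_not_exceptional hj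
  have hsc : ∀ i, SecondCountableTopology (Aff (hT i) (ω i)) := fun i =>
    have : SecondCountableTopology (T i ≃g T i) := secondCountableTopology_aut
    TopologicalSpace.Subtype.secondCountableTopology _
  have : SecondCountableTopology (AffProd hT ω) := inferInstance
  let _ := vertexAction hT ω j
  refine isTransient_of_stabilizer (Ω := W j) (x := v) (fun x y => ?_) hγ hκ
    (fun g hg => h1 (g j) ⟨g, hg, rfl⟩) h2 h3
  exact (isOpen_setOf_apply_eq (G := T j) x y).preimage
    (continuous_subtype_val.comp (continuous_apply j))

end Product

end TreeWalk

theorem mainTheorem8 (k : ℕ) (V : Fin k → Type*) (T : ∀ i, SimpleGraph (V i))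
    (d : Fin k → ℕ) (hd : ∀ i, 3 ≤ d i)
    (hT : ∀ i, TreeWalk.IsHomogeneousTree (T i) (d i))
    (o : ∀ i, V i) (ω : ∀ i, TreeWalk.Ends (hT i).isTree)
    [MeasurableSpace (TreeWalk.AffProd (fun i => (hT i).isTree) ω)]
    [BorelSpace (TreeWalk.AffProd (fun i => (hT i).isTree) ω)]
    (μ : Measure (TreeWalk.AffProd (fun i => (hT i).isTree) ω)) [IsProbabilityMeasure μ]
    (hμ : ¬ TreeWalk.FullyExceptional o (TreeWalk.closedGroupGenerated μ)) :
    TreeWalk.IsTransient μ := by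
  have : ∀ i, Countable (V i) := fun i => (hT i).countable
  exact TreeWalk.isTransient_of_not_fullyExceptional o μ hμ
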